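/- Let $C$ be an algebraically closed field of characteristic zero, let $K=C(x)$ with the derivation $d/dx$, and let $K[D]$ be the ring of linear differential operators over $K$ (with $Dq=qD+q'$ for $q\in K$), where an operator $p_0+p_1D+\cdots+p_rD^r$ with $p_r\neq0$ has order $r$. For nonzero $L,M\in K[D]$, the symmetric product $L\otimes M$ is the unique monic operator of lowest order in $K[D]$ such that $(L\otimes M)\cdot(fg)=0$ whenever $f$ is a solution of $L$ and $g$ is a solution of $M$ in a common differential field extension of $K$ (regardless of which one); $L^{\otimes s}=L\otimes\cdots\otimes L$ ($s$ factors) denotes the $s$th symmetric power. We say that $L$ has only algebraic solutions if there is a differential field $E$ that is an extension of $K$ of finite degree in which the solution space of $L$ has dimension $\operatorname{ord}(L)$ over the field of constants of $E$. We say that $L$ has a transcendental solution if some differential field extension of $K$ with field of constants $C$ contains a solution of $L$ that is transcendental over $K$. Let $L\in C(x)[D]$ be nonzero. 1. If $L$ has only algebraic solutions, then $\operatorname{ord}(L^{\otimes s})=\operatorname{O}(s)$ as $s\to\infty$. 2. If $L$ has at least one transcendental solution and $D^2$ is a right factor of $L$ in $C(x)[D]$, then $\operatorname{ord}(L^{\otimes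 s})=\Omega(s^2)$ as $s\to\infty$; that is, there is a constant $c>0$ with $\operatorname{ord}(L^{\otimes s})\ge c\,s^2$ for all sufficiently large $s$. -/

import Mathlib

open scoped Differential

universe u

/-! ### The derivation `d/dx` on the field of rational functions -/

namespace RatFuncDeriv

open scoped Polynomial

variable {C : Type*} [Field C]

/-- The derivative of a rational function, by the quotient rule applied to its reduced fraction. -/
noncomputable def derivFun (f : RatFunc C) : RatFunc C :=
  (algebraMap C[X] (RatFunc C) (Polynomial.derivative f.num) * algebraMap C[X] (RatFunc C) f.denom
    - algebraMap C[X] (RatFunc C) f.num *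
      algebraMap C[X] (RatFunc C) (Polynomial.derivative f.denom))
    / (algebraMap C[X] (RatFunc C) f.denom) ^ 2

/-- The quotient rule, for an arbitrary representation as a fraction. -/
theorem derivFun_div (p q : C[X]) (hq : q ≠ 0) :
    derivFun (algebraMap C[X] (RatFunc C) p / algebraMap C[X] (RatFunc C) q) =
      (algebraMap C[X] (RatFunc C) (Polynomial.derivative p) * algebraMap C[X] (RatFunc C) q
        - algebraMap C[X] (RatFunc C) p * algebraMap C[X] (RatFunc C) (Polynomial.derivative q))
        / (algebraMap C[X] (RatFunc C) q) ^ 2 := by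
  set f : RatFunc C := algebraMap C[X] (RatFunc C) p / algebraMap C[X] (RatFunc C) q with hf
  have hd : f.denom ≠ 0 := f.denom_ne_zero
  have h1 : f.num * q = p * f.denom := by
    rw [← RatFunc.num_div_denom f] at hf
    have hd' : algebraMap C[X] (RatFunc C) f.denom ≠ 0 := RatFunc.algebraMap_ne_zero hd
    have hq' : algebraMap C[X] (RatFunc C) q ≠ 0 := RatFunc.algebraMap_ne_zero hq
    rw [div_eq_div_iff hd' hq', ← map_mul, ← map_mul] at hf
    exact RatFunc.algebraMap_injective C hf
  have h2 := congrArg Polynomial.derivative h1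
  rw [Polynomial.derivative_mul, Polynomial.derivative_mul] at h2
  have hd' : algebraMap C[X] (RatFunc C) f.denom ≠ 0 := RatFunc.algebraMap_ne_zero hd
  have hq' : algebraMap C[X] (RatFunc C) q ≠ 0 := RatFunc.algebraMap_ne_zero hq
  have e1 := congrArg (algebraMap C[X] (RatFunc C)) h1
  have e2 := congrArg (algebraMap C[X] (RatFunc C)) h2
  simp only [map_mul, map_add] at e1 e2
  unfold derivFun
  rw [div_eq_div_iff (pow_ne_zero 2 hd') (pow_ne_zero 2 hq')]
  generalize algebraMap C[X] (RatFunc C) f.denom = d at *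
  generalize algebraMap C[X] (RatFunc C) f.num = n at *
  generalize algebraMap C[X] (RatFunc C) (Polynomial.derivative f.denom) = d1 at *
  generalize algebraMap C[X] (RatFunc C) (Polynomial.derivative f.num) = n1 at *
  generalize algebraMap C[X] (RatFunc C) (Polynomial.derivative p) = p1 at *
  generalize algebraMap C[X] (RatFunc C) (Polynomial.derivative q) = q1 at *
  generalize algebraMap C[X] (RatFunc C) q = b at *
  generalize algebraMap C[X] (RatFunc C) p = a at *
  linear_combination (d * b) * e2 - (d1 * b + d * q1) * e1

theorem derivFun_add (f g : RatFunc C) : derivFun (f + g) = derivFun f + derivFun g := by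
  induction f using RatFunc.induction_on with
  | f p q hq =>
  induction g using RatFunc.induction_on with
  | f r s hs =>
  have hq' : algebraMap C[X] (RatFunc C) q ≠ 0 := RatFunc.algebraMap_ne_zero hq
  have hs' : algebraMap C[X] (RatFunc C) s ≠ 0 := RatFunc.algebraMap_ne_zero hs
  rw [div_add_div _ _ hq' hs', ← map_mul, ← map_mul, ← map_mul, ← map_add,
    derivFun_div _ _ (mul_ne_zero hq hs), derivFun_div _ _ hq, derivFun_div _ _ hs]
  simp only [map_mul, map_add, Polynomial.derivative_mul]
  field_simp
  ring

theorem derivFun_mul (f g : RatFunc C) :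
    derivFun (f * g) = f * derivFun g + g * derivFun f := by
  induction f using RatFunc.induction_on with
  | f p q hq =>
  induction g using RatFunc.induction_on with
  | f r s hs =>
  have hq' : algebraMap C[X] (RatFunc C) q ≠ 0 := RatFunc.algebraMap_ne_zero hq
  have hs' : algebraMap C[X] (RatFunc C) s ≠ 0 := RatFunc.algebraMap_ne_zero hs
  rw [div_mul_div_comm, ← map_mul, ← map_mul,
    derivFun_div _ _ (mul_ne_zero hq hs), derivFun_div _ _ hq, derivFun_div _ _ hs]
  simp only [map_mul, map_add, Polynomial.derivative_mul]
  field_simp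
  ring

/-- The derivative with respect to `x`, as an additive map. -/
noncomputable def derivHom (C : Type*) [Field C] : RatFunc C →+ RatFunc C :=
  AddMonoidHom.mk' derivFun derivFun_add

/-- A differential ring from an additive map that satisfies the Leibniz rule. -/
@[reducible]
def mkDifferential {R : Type*} [CommRing R] (d : R →+ R)
    (h : ∀ a b, d (a * b) = a * d b + b * d a) : Differential R where
  deriv := Derivation.mk' d.toIntLinearMap h

end RatFuncDeriv

/-- The field `C(x)` with the usual derivation with respect to `x`. -/
noncomputable instance RatFunc.instDifferentialX {C : Type*} [Field C] :
    Differential (RatFunc C) :=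
  RatFuncDeriv.mkDifferential (RatFuncDeriv.derivHom C) RatFuncDeriv.derivFun_mul

/-! ### Linear differential operators -/

/-- The set `K[D]` of linear differential operators `p₀ + p₁ D + ⋯ + p_r D ^ r` over a differential
field `K`. An operator is stored as the polynomial with (left) coefficients `p₀, …, p_r`; the
multiplication, given below, is not the one of polynomials. -/
def DiffOp (K : Type u) [Field K] [Differential K] : Type u := Polynomial K

namespace DiffOp

open scoped Polynomial

section Mul

variable {K : Type u} [Field K] [Differential K]

/-- `D * ∑ q_j D ^ j = ∑ q_j′ D ^ j + ∑ q_j D ^ (j + 1)`, that is, `D q = q D + q′`. -/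
noncomputable def dMul : K[X] →+ K[X] where
  toFun Q := Differential.mapCoeffs Q + Polynomial.X * Q
  map_zero' := by simp
  map_add' P Q := by simp only [map_add, mul_add]; abel

/-- `(∑ p_i D ^ i) * Q = ∑ p_i (D ^ i * Q)`. -/
noncomputable def mulFun (P Q : K[X]) : K[X] :=
  P.sum fun i p => Polynomial.C p * (dMul^[i]) Q

theorem dMul_C_mul (a : K) (Q : K[X]) :
    dMul (Polynomial.C a * Q) = Polynomial.C a′ * Q + Polynomial.C a * dMul Q := by
  simp only [dMul, AddMonoidHom.coe_mk, ZeroHom.coe_mk, Derivation.leibniz, smul_eq_mul,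
    Differential.mapCoeffs_C]
  ring

theorem dMul_iterate_one (n : ℕ) : (dMul^[n]) (1 : K[X]) = Polynomial.X ^ n := by
  induction n with
  | zero => rfl
  | succ n ih =>
    rw [Function.iterate_succ_apply', ih]
    simp [dMul, Derivation.leibniz_pow, pow_succ']

theorem add_mulFun (P Q R : K[X]) : mulFun (P + Q) R = mulFun P R + mulFun Q R := by
  unfold mulFun
  exact Polynomial.sum_add_index _ _ _ (by simp) (by intros; simp [add_mul])

theorem mulFun_add (P Q R : K[X]) : mulFun P (Q + R) = mulFun P Q + mulFun P R := by
  unfold mulFun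
  simp only [Polynomial.sum_def, ← Finset.sum_add_distrib, iterate_map_add, mul_add]

theorem monomial_mulFun (n : ℕ) (a : K) (Q : K[X]) :
    mulFun (Polynomial.monomial n a) Q = Polynomial.C a * (dMul^[n]) Q := by
  unfold mulFun
  exact Polynomial.sum_monomial_index _ _ (by simp)

theorem zero_mulFun (Q : K[X]) : mulFun 0 Q = 0 := by simp [mulFun]

theorem mulFun_zero (P : K[X]) : mulFun P 0 = 0 := by
  simp [mulFun, Polynomial.sum_def, iterate_map_zero]

theorem one_mulFun (Q : K[X]) : mulFun 1 Q = Q := by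
  rw [← Polynomial.monomial_zero_one, monomial_mulFun]; simp

theorem mulFun_one (P : K[X]) : mulFun P 1 = P := by
  simp only [mulFun, dMul_iterate_one]
  exact Polynomial.sum_C_mul_X_pow_eq P

theorem C_mul_mulFun (a : K) (P Q : K[X]) :
    mulFun (Polynomial.C a * P) Q = Polynomial.C a * mulFun P Q := by
  induction P using Polynomial.induction_on' with
  | add P R hP hR => rw [mul_add, add_mulFun, hP, hR, add_mulFun, mul_add]
  | monomial n b =>
    rw [Polynomial.C_mul_monomial, monomial_mulFun, monomial_mulFun, map_mul, mul_assoc]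

theorem dMul_mulFun (P Q : K[X]) : mulFun (dMul P) Q = dMul (mulFun P Q) := by
  induction P using Polynomial.induction_on' with
  | add P R hP hR => rw [map_add, add_mulFun, hP, hR, add_mulFun, map_add]
  | monomial n b =>
    have : dMul (Polynomial.monomial n b) =
        Polynomial.monomial n b′ + Polynomial.monomial (n + 1) b := by
      simp [dMul, Polynomial.X_mul_monomial]
    rw [this, add_mulFun, monomial_mulFun, monomial_mulFun, monomial_mulFun, dMul_C_mul,
      Function.iterate_succ_apply']

theorem dMul_iterate_mulFun (n : ℕ) (P Q : K[X]) :
    mulFun ((dMul^[n]) P) Q = (dMul^[n]) (mulFun P Q) := by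
  induction n with
  | zero => rfl
  | succ n ih => rw [Function.iterate_succ_apply', dMul_mulFun, ih, Function.iterate_succ_apply']

theorem mulFun_assoc (P Q R : K[X]) : mulFun (mulFun P Q) R = mulFun P (mulFun Q R) := by
  induction P using Polynomial.induction_on' with
  | add P S hP hS => rw [add_mulFun, add_mulFun, hP, hS, add_mulFun]
  | monomial n b => rw [monomial_mulFun, monomial_mulFun, C_mul_mulFun, dMul_iterate_mulFun]

end Mul

variable (K : Type u) [Field K] [Differential K]

noncomputable instance : AddCommGroup (DiffOp K) := inferInstanceAs (AddCommGroup K[X])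

/-- The non-commutative ring `K[D]`. -/
noncomputable instance : Ring (DiffOp K) :=
  { (inferInstance : AddCommGroup (DiffOp K)) with
    mul := fun P Q => mulFun (K := K) P Q
    one := (1 : K[X])
    left_distrib := mulFun_add (K := K)
    right_distrib := add_mulFun (K := K)
    zero_mul := zero_mulFun (K := K)
    mul_zero := mulFun_zero (K := K)
    one_mul := one_mulFun (K := K)
    mul_one := mulFun_one (K := K)
    mul_assoc := mulFun_assoc (K := K) }

/-- The operator `D`. -/
noncomputable def D : DiffOp K := (Polynomial.X : K[X])

variable {K}

/-- The coefficient `p_i` of `p₀ + p₁ D + ⋯ + p_r D ^ r`. -/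
noncomputable def coeff (P : DiffOp K) (i : ℕ) : K := Polynomial.coeff (R := K) P i

/-- The order of an operator (meaningful for `P ≠ 0`). -/
noncomputable def ord (P : DiffOp K) : ℕ := Polynomial.natDegree (R := K) P

/-- The action `(p₀ + ⋯ + p_r D ^ r) · y = p₀ y + p₁ y′ + ⋯ + p_r y⁽ʳ⁾` of an operator on an
element of a differential field extension of `K`. -/
noncomputable def act (P : DiffOp K) {F : Type*} [Field F] [Differential F] [Algebra K F]
    (y : F) : F :=
  ∑ i ∈ Finset.range (P.ord + 1), algebraMap K F (P.coeff i) * (Differential.deriv^[i]) y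

/-- `P` is monic: the coefficient of `D ^ ord P` is `1`. -/
def IsMonic (P : DiffOp K) : Prop := P.coeff P.ord = 1

/-- `M` is a right factor of `P` in `K[D]`. -/
def IsRightFactor (M P : DiffOp K) : Prop := ∃ Q : DiffOp K, P = Q * M

/-! ### Solution spaces -/

/-- The field of constants of a differential field. -/
def constants (F : Type*) [Field F] [Differential F] : Subfield F where
  carrier := {c | c′ = 0}
  mul_mem' {a b} ha hb := by
    simp only [Set.mem_ofPred_eq] at *
    simp [ha, hb]
  one_mem' := by simp
  add_mem' {a b} ha hb := by
    simp only [Set.mem_ofPred_eq] at *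
    simp [ha, hb]
  zero_mem' := by simp
  neg_mem' {a} ha := by
    simp only [Set.mem_ofPred_eq] at *
    simp [ha]
  inv_mem' a ha := by
    simp only [Set.mem_ofPred_eq] at *
    simp [Derivation.leibniz_inv, ha]

theorem deriv_iterate_constants_smul {F : Type*} [Field F] [Differential F] (c : constants F)
    (y : F) (n : ℕ) :
    (Differential.deriv^[n]) (c • y) = (c : F) * (Differential.deriv^[n]) y := by
  induction n with
  | zero => rfl
  | succ n ih =>
    have hc : (c : F)′ = 0 := c.2
    rw [Function.iterate_succ_apply', ih, Function.iterate_succ_apply', Derivation.leibniz, hc]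
    simp

/-- The solution space `V(L)` of `L` in a differential field `F`, a vector space over the field of
constants of `F`. -/
noncomputable def solutionSpace (L : DiffOp K) (F : Type*) [Field F] [Differential F]
    [Algebra K F] : Submodule (constants F) F where
  carrier := {y | L.act y = 0}
  add_mem' {a b} ha hb := by
    simp only [Set.mem_ofPred_eq] at *
    have : L.act (a + b) = L.act a + L.act b := by
      simp only [act, iterate_map_add, mul_add, Finset.sum_add_distrib]
    rw [this, ha, hb, add_zero]
  zero_mem' := by simp [act, iterate_map_zero]
  smul_mem' c y hy := by
    simp only [Set.mem_ofPred_eq] at *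
    have : L.act (c • y) = (c : F) * L.act y := by
      simp only [act, deriv_iterate_constants_smul, Finset.mul_sum]
      exact Finset.sum_congr rfl fun i _ => by ring
    rw [this, hy, mul_zero]

/-- `L` has only algebraic solutions: in some differential field `E` that is an extension of `K` of
finite degree, the solution space of `L` has dimension `ord L`. -/
def OnlyAlgebraicSolutions (L : DiffOp K) : Prop :=
  ∃ (E : Type u) (_ : Field E) (_ : Differential E) (_ : Algebra K E)
    (_ : DifferentialAlgebra K E),
    FiniteDimensional K E ∧ Module.finrank (constants E) (L.solutionSpace E) = L.ord

/-- `L` has a transcendental solution: some differential field extension `F` of `K` without new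
constants contains a solution of `L` that is transcendental over `K`. -/
def HasTranscendentalSolution (L : DiffOp K) : Prop :=
  ∃ (F : Type u) (_ : Field F) (_ : Differential F) (_ : Algebra K F)
    (_ : DifferentialAlgebra K F) (_ : Differential.ContainConstants K F),
    ∃ f ∈ L.solutionSpace F, Transcendental K f

/-! ### Symmetric products and symmetric powers -/

/-- `P · (f g) = 0` whenever `f` is a solution of `L` and `g` is a solution of `M`, regardless of
the differential field extension of `K` to which `f` and `g` belong. -/
def KillsProducts (L M P : DiffOp K) : Prop :=
  ∀ (F : Type u) [Field F] [Differential F] [Algebra K F] [DifferentialAlgebra K F] (f g : F),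
    L.act f = 0 → M.act g = 0 → P.act (f * g) = 0

/-- `P` is a monic operator of lowest order that annihilates all products of a solution of `L` and
a solution of `M`. -/
structure IsSymProd (L M P : DiffOp K) : Prop where
  monic : P.IsMonic
  kills : KillsProducts L M P
  minimal : ∀ Q : DiffOp K, Q.IsMonic → KillsProducts L M Q → P.ord ≤ Q.ord

section Existence

/-- A pair of solutions of `L` and `M` in a common differential field; auxiliary for the proof that
symmetric products exist. -/
structure SolPair (L M : DiffOp K) : Type (u + 1) where
  F : Type u
  [field : Field F]
  [diff : Differential F]
  [alg : Algebra K F]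
  [diffAlg : DifferentialAlgebra K F]
  f : F
  g : F
  hf : L.act f = 0
  hg : M.act g = 0

attribute [instance] SolPair.field SolPair.diff SolPair.alg SolPair.diffAlg

variable {L M : DiffOp K}

/-- The componentwise derivation on the product of all the fields. -/
def SolPair.δ : ((d : SolPair L M) → d.F) →+ ((d : SolPair L M) → d.F) where
  toFun a d := Differential.deriv (a d)
  map_zero' := by ext; simp
  map_add' a b := by ext; simp

theorem SolPair.δ_smul (c : K) (a : (d : SolPair L M) → d.F) :
    SolPair.δ (c • a) = c′ • a + c • SolPair.δ a := by
  ext d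
  simp only [δ, AddMonoidHom.coe_mk, ZeroHom.coe_mk, Pi.smul_apply, Pi.add_apply]
  simp only [Algebra.smul_def, Derivation.leibniz, deriv_algebraMap, Algebra.algebraMap_self,
    RingHom.id_apply]
  ring

theorem SolPair.δ_mul (a b : (d : SolPair L M) → d.F) :
    SolPair.δ (a * b) = a * SolPair.δ b + SolPair.δ a * b := by
  ext d
  simp only [δ, AddMonoidHom.coe_mk, ZeroHom.coe_mk, Pi.mul_apply, Pi.add_apply,
    Derivation.leibniz, smul_eq_mul]
  ring

theorem SolPair.δ_iterate (a : (d : SolPair L M) → d.F) (n : ℕ) (d : SolPair L M) :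
    (SolPair.δ^[n]) a d = (Differential.deriv^[n]) (a d) := by
  induction n with
  | zero => rfl
  | succ n ih =>
    rw [Function.iterate_succ_apply', Function.iterate_succ_apply', ← ih]; rfl

theorem coeff_ord_ne_zero {P : DiffOp K} (hP : P ≠ 0) : P.coeff P.ord ≠ 0 :=
  Polynomial.leadingCoeff_ne_zero.mpr hP

theorem SolPair.exists_stable (N : DiffOp K) (hN : N ≠ 0) (a : (d : SolPair L M) → d.F)
    (ha : ∀ d, N.act (a d) = 0) :
    ∃ V : Submodule K ((d : SolPair L M) → d.F), V.FG ∧ a ∈ V ∧ ∀ v ∈ V, SolPair.δ v ∈ V := by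
  refine ⟨Submodule.span K ((fun i => (SolPair.δ^[i]) a) '' (Finset.range (N.ord + 1) : Set ℕ)),
    Submodule.fg_span ((Finset.finite_toSet _).image _),
    Submodule.subset_span ⟨0, by simp, rfl⟩, ?_⟩
  set S := (fun i => (SolPair.δ^[i]) a) '' (Finset.range (N.ord + 1) : Set ℕ)
  -- the relation given by the operator, differentiated once
  have hgen : ∀ i ≤ N.ord, (SolPair.δ^[i]) a ∈ Submodule.span K S := fun i hi =>
    Submodule.subset_span ⟨i, by simpa using Nat.lt_succ_of_le hi, rfl⟩
  have hrel : ∑ i ∈ Finset.range (N.ord + 1), N.coeff i • (SolPair.δ^[i]) a = 0 := by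
    ext d
    have := ha d
    simp only [act] at this
    simpa [Finset.sum_apply, SolPair.δ_iterate, Algebra.smul_def] using this
  have hlast : (SolPair.δ^[N.ord + 1]) a ∈ Submodule.span K S := by
    have h1 := congrArg SolPair.δ hrel
    rw [map_sum, map_zero, Finset.sum_range_succ] at h1
    simp only [SolPair.δ_smul, ← Function.iterate_succ_apply' (f := SolPair.δ)] at h1
    have h2 : N.coeff N.ord • (SolPair.δ^[N.ord + 1]) a ∈ Submodule.span K S := by
      have h3 : N.coeff N.ord • (SolPair.δ^[N.ord + 1]) a =
          -(∑ i ∈ Finset.range N.ord, ((N.coeff i)′ • (SolPair.δ^[i]) a +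
            N.coeff i • (SolPair.δ^[i + 1]) a) + (N.coeff N.ord)′ • (SolPair.δ^[N.ord]) a) := by
        rw [eq_neg_iff_add_eq_zero, ← h1]
        abel
      rw [h3]
      refine Submodule.neg_mem _ (Submodule.add_mem _ (Submodule.sum_mem _ fun i hi => ?_)
        (Submodule.smul_mem _ _ (hgen _ le_rfl)))
      have := Finset.mem_range.mp hi
      exact Submodule.add_mem _ (Submodule.smul_mem _ _ (hgen _ this.le))
        (Submodule.smul_mem _ _ (hgen _ this))
    simpa [smul_smul, inv_mul_cancel₀ (coeff_ord_ne_zero hN)] using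
      Submodule.smul_mem _ (N.coeff N.ord)⁻¹ h2
  intro v hv
  induction hv using Submodule.span_induction with
  | mem x hx =>
    obtain ⟨i, hi, rfl⟩ := hx
    have hi' : i < N.ord + 1 := by simpa using hi
    simp only [← Function.iterate_succ_apply' (f := SolPair.δ)]
    rcases Nat.lt_or_ge i N.ord with h | h
    · exact hgen _ h
    · have : i = N.ord := by omega
      rw [this]; exact hlast
  | zero => rw [map_zero]; exact Submodule.zero_mem _
  | add x y _ _ hx hy => rw [map_add]; exact Submodule.add_mem _ hx hy
  | smul c x hx hx' =>
    rw [SolPair.δ_smul]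
    exact Submodule.add_mem _ (Submodule.smul_mem _ _ hx) (Submodule.smul_mem _ _ hx')

theorem act_eq_sum (P : DiffOp K) {F : Type*} [Field F] [Differential F] [Algebra K F] (y : F)
    (n : ℕ) (hn : P.ord < n) :
    P.act y = ∑ i ∈ Finset.range n, algebraMap K F (P.coeff i) * (Differential.deriv^[i]) y := by
  unfold act
  refine Finset.sum_subset (by intro i; simp; omega) fun i _ hi => ?_
  have : P.coeff i = 0 := Polynomial.coeff_eq_zero_of_natDegree_lt
    (show P.ord < i by simpa using hi)
  simp [this]

theorem exists_kills (hL : L ≠ 0) (hM : M ≠ 0) : ∃ P : DiffOp K, P ≠ 0 ∧ KillsProducts L M P := by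
  obtain ⟨V, hVfg, hV, hVδ⟩ := SolPair.exists_stable (L := L) (M := M) L hL (fun d => d.f)
    fun d => d.hf
  obtain ⟨W, hWfg, hW, hWδ⟩ := SolPair.exists_stable (L := L) (M := M) M hM (fun d => d.g)
    fun d => d.hg
  have hfg : (V * W).FG := hVfg.mul hWfg
  have hδ : ∀ v ∈ V * W, SolPair.δ v ∈ V * W := by
    intro v hv
    induction hv using Submodule.mul_induction_on' with
    | mem_mul_mem m hm n hn =>
      rw [SolPair.δ_mul]
      exact Submodule.add_mem _ (Submodule.mul_mem_mul hm (hWδ _ hn))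
        (Submodule.mul_mem_mul (hVδ _ hm) hn)
    | add x _ y _ hx hy => rw [map_add]; exact Submodule.add_mem _ hx hy
  set a : (d : SolPair L M) → d.F := fun d => d.f * d.g with ha
  have hmem : ∀ i, (SolPair.δ^[i]) a ∈ V * W := by
    intro i
    induction i with
    | zero => exact Submodule.mul_mem_mul hV hW
    | succ i ih => rw [Function.iterate_succ_apply']; exact hδ _ ih
  have : Module.Finite K (V * W : Submodule K ((d : SolPair L M) → d.F)) :=
    Module.Finite.iff_fg.mpr hfg
  have hdep : ¬ LinearIndependent K
      (fun i : ℕ => (⟨(SolPair.δ^[i]) a, hmem i⟩ : (V * W : Submodule K _))) := by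
    intro h
    have := h.finite
    exact not_finite ℕ
  have hdep' : ¬ Function.Injective (Finsupp.linearCombination K
      (fun i : ℕ => (⟨(SolPair.δ^[i]) a, hmem i⟩ : (V * W : Submodule K _)))) := hdep
  rw [← LinearMap.ker_eq_bot, Submodule.eq_bot_iff] at hdep'
  push Not at hdep'
  obtain ⟨c, hc, hc0⟩ := hdep'
  set p : K[X] := ∑ i ∈ c.support, Polynomial.monomial i (c i) with hp
  have hpc : ∀ i, p.coeff i = c i := by
    intro i
    simp only [hp, Polynomial.finsetSum_coeff, Polynomial.coeff_monomial, Finset.sum_ite_eq',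
      Finsupp.mem_support_iff]
    by_cases h : c i = 0 <;> simp [h]
  refine ⟨p, fun h => hc0 ?_, ?_⟩
  · ext i
    rw [← hpc i, show p = (0 : K[X]) from h]; simp
  · intro F _ _ _ _ f g hf hg
    let d : SolPair L M := ⟨F, f, g, hf, hg⟩
    have h1 : (c.sum fun i r => r • (SolPair.δ^[i]) a) = 0 := by
      have := congrArg Subtype.val (LinearMap.mem_ker.mp hc)
      simpa [Finsupp.linearCombination_apply, Finsupp.sum] using this
    have h2 := congrFun h1 d
    simp only [Finsupp.sum, Finset.sum_apply, Pi.smul_apply, SolPair.δ_iterate] at h2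
    obtain ⟨n, hn⟩ : ∃ n, c.support ⊆ Finset.range n := c.support.exists_nat_subset_range
    let P : DiffOp K := p
    have hPc : ∀ i, P.coeff i = c i := hpc
    change P.act (f * g) = 0
    rw [act_eq_sum P (f * g) (max n (P.ord + 1)) (by omega)]
    refine Eq.trans ?_ h2
    symm
    refine Finset.sum_subset_zero_on_sdiff (hn.trans (by intro i; simp; omega)) ?_ ?_
    · intro i hi
      have : c i = 0 := by simpa using (Finset.mem_sdiff.mp hi).2
      rw [hPc, this]; simp
    · intro i _
      rw [hPc, Algebra.smul_def]

theorem exists_monic_kills {P : DiffOp K} (hP : P ≠ 0) (h : KillsProducts L M P) :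
    ∃ Q : DiffOp K, Q.IsMonic ∧ KillsProducts L M Q ∧ Q.ord = P.ord := by
  have h0 := coeff_ord_ne_zero hP
  set b := (P.coeff P.ord)⁻¹ with hb
  have hb0 : b ≠ 0 := inv_ne_zero h0
  let Q : DiffOp K := Polynomial.C b * (show K[X] from P)
  have hord : Q.ord = P.ord := Polynomial.natDegree_C_mul hb0
  have hco : ∀ i, Q.coeff i = b * P.coeff i := fun i => Polynomial.coeff_C_mul _
  refine ⟨Q, ?_, ?_, hord⟩
  · rw [IsMonic, hord, hco, hb, inv_mul_cancel₀ h0]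
  · intro F _ _ _ _ f g hf hg
    have := h F f g hf hg
    simp only [act] at this ⊢
    simp only [hord, hco, map_mul, mul_assoc, ← Finset.mul_sum, this, mul_zero]

/-- The symmetric product exists and is unique. -/
theorem existsUnique_isSymProd (hL : L ≠ 0) (hM : M ≠ 0) : ∃! P : DiffOp K, IsSymProd L M P := by
  classical
  obtain ⟨P₀, hP₀, hk₀⟩ := exists_kills hL hM
  obtain ⟨Q₀, hQ₀, hQk₀, -⟩ := exists_monic_kills hP₀ hk₀
  have hex : ∃ n, ∃ P : DiffOp K, P.IsMonic ∧ KillsProducts L M P ∧ P.ord = n :=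
    ⟨_, Q₀, hQ₀, hQk₀, rfl⟩
  obtain ⟨P, hPm, hPk, hPn⟩ := Nat.find_spec hex
  have hPs : IsSymProd L M P :=
    ⟨hPm, hPk, fun Q hQ hQk => hPn ▸ Nat.find_min' hex ⟨Q, hQ, hQk, rfl⟩⟩
  refine ⟨P, hPs, fun Q hQ => ?_⟩
  by_contra hne
  have hordeq : Q.ord = P.ord :=
    le_antisymm (hQ.minimal P hPm hPk) (hPs.minimal Q hQ.monic hQ.kills)
  have hR : Q - P ≠ 0 := sub_ne_zero.mpr hne
  have hco : ∀ i, (Q - P).coeff i = Q.coeff i - P.coeff i := fun i =>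
    Polynomial.coeff_sub (R := K) Q P i
  have hle : (Q - P).ord ≤ P.ord := by
    refine (Polynomial.natDegree_sub_le (R := K) Q P).trans ?_
    exact max_le hordeq.le le_rfl
  have hkR : KillsProducts L M (Q - P) := by
    intro F _ _ _ _ f g hf hg
    have h1 := hQ.kills F f g hf hg
    have h2 := hPk F f g hf hg
    rw [act_eq_sum _ _ (P.ord + 1) (by omega)] at h1 h2 ⊢
    simp only [hco, map_sub, sub_mul, Finset.sum_sub_distrib, h1, h2, sub_zero]
  obtain ⟨S, hSm, hSk, hSo⟩ := exists_monic_kills hR hkR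
  have h3 := hPs.minimal S hSm hSk
  have h4 : (Q - P).ord = P.ord := by omega
  have h5 := coeff_ord_ne_zero hR
  rw [h4, hco, hPm] at h5
  have h6 : Q.coeff P.ord = 1 := hordeq ▸ hQ.monic
  exact h5 (by rw [h6, sub_self])

end Existence

open Classical in
/-- The symmetric product `L ⊗ M` of two nonzero operators. -/
noncomputable def symProd (L M : DiffOp K) : DiffOp K :=
  if h : L ≠ 0 ∧ M ≠ 0 then (existsUnique_isSymProd h.1 h.2).choose else 0

/-- `symProd L M` is the monic operator of lowest order that annihilates all products of a solution
of `L` and a solution of `M`. -/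
theorem symProd_spec {L M : DiffOp K} (hL : L ≠ 0) (hM : M ≠ 0) :
    IsSymProd L M (symProd L M) := by
  have h : L ≠ 0 ∧ M ≠ 0 := ⟨hL, hM⟩
  unfold symProd
  rw [dif_pos h]
  exact (existsUnique_isSymProd h.1 h.2).choose_spec.1

/-- The symmetric power `L ^ ⊗s = L ⊗ ⋯ ⊗ L` (`s` factors), with the convention that the empty
product is `D`, the monic operator of lowest order with solution `1`. -/
noncomputable def symPow (L : DiffOp K) : ℕ → DiffOp K
  | 0 => D K
  | 1 => L
  | s + 2 => symProd (symPow L (s + 1)) L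

end DiffOp

/-! Both bounds compare the order of an operator with the dimension, over the constants, of a space
of its solutions. By a Wronskian argument (`linearIndependent_of_horizontal`), solutions independent
over the constants have jets independent over the field, so this dimension never exceeds the order.

Algebraic case: enlarge `E` to a Galois extension of `K` and let `V` be the solution space of `L`
there. Then the order of the `s`th symmetric power is exactly `dim V ^ s` (`full_symProd`,
`ord_symPow_of_full`). Indeed `V ^ s` is stable under the Galois group, so its unique monic
annihilator over `E` of order `dim V ^ s` has invariant coefficients and lies in `K[D]`. It also
kills products of solutions from any other extension, because in a compositum with `E` all solutions
are constant combinations of those from `E`. Finally, in a `K`-basis of `E`, elements of `V ^ s`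
have coordinates with denominator `q ^ (s + 1)` and numerators of degree `O(s)`, so `dim V ^ s =
O(s)` (`exists_finrank_pow_le`).

Transcendental case: the factor `D ^ 2` makes `1` and `x` solutions. If `f` is a transcendental
solution, then `x` and `f` are algebraically independent over the constants, so the quadratically
many monomials `x ^ i * f ^ j` with `i + j ≤ s` are independent solutions of the `s`th symmetric
power (`sq_le_ord_symPow`). -/

namespace DiffOp

/-! ### Horizontal vectors and jets -/

section Horizontal

variable {F : Type*} [Field F] [Differential F]

/-- Vectors that are annihilated by a connection `δ` and linearly independent over the constants
are linearly independent over the field. -/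
theorem linearIndependent_of_horizontal {M : Type*} [AddCommGroup M] [Module F M] (δ : M →+ M)
    (hδ : ∀ (c : F) (m : M), δ (c • m) = c′ • m + c • δ m) {ι : Type*} {v : ι → M}
    (hv : ∀ i, δ (v i) = 0) (hli : LinearIndependent (constants F) v) :
    LinearIndependent F v := by
  classical
  rw [linearIndependent_iff'] at hli ⊢
  intro s
  induction s using Finset.induction_on with
  | empty => simp
  | insert a t ha ih =>
    intro c hc
    -- Otherwise scale the coefficient of `v a` to `1`. Applying `δ` removes that term, so by
    -- induction the remaining ratios have derivative zero and the relation is one over the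
    -- constants.
    have hca : c a = 0 := by
      by_contra hca
      have h1 : v a + ∑ i ∈ t, (c i / c a) • v i = 0 := by
        have := congrArg (fun m => (c a)⁻¹ • m) hc
        simpa [Finset.sum_insert ha, Finset.smul_sum, smul_smul, inv_mul_cancel₀ hca,
          div_eq_inv_mul] using this
      have h2 : ∑ i ∈ t, (c i / c a)′ • v i = 0 := by
        have := congrArg δ h1
        simpa [hδ, hv] using this
      have h3 := ih _ h2
      -- The value `0` is only a default outside `insert a t`: `h3` gives the condition on `t`, and
      -- the ratio at `a` is `1`.
      let b : ι → constants F := fun i =>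
        if h : (c i / c a)′ = 0 then ⟨c i / c a, h⟩ else 0
      have h4 : ∑ i ∈ insert a t, b i • v i = 0 := by
        rw [Finset.sum_insert ha]
        have hba : b a • v a = v a := by
          have : b a = 1 := by
            apply Subtype.ext
            simp [b, div_self hca]
          rw [this, one_smul]
        rw [hba]
        refine Eq.trans (congrArg _ (Finset.sum_congr rfl fun i hi => ?_)) h1
        simp only [b, dif_pos (h3 i hi)]
        rfl
      have h5 := hli _ b h4 a (Finset.mem_insert_self a t)
      have h6 := congrArg Subtype.val h5
      simp [b, div_self hca] at h6
    intro i hi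
    rw [Finset.sum_insert ha, hca, zero_smul, zero_add] at hc
    rcases Finset.mem_insert.mp hi with rfl | hi
    · exact hca
    · exact ih _ hc i hi

/-- The vector of the first `n` derivatives. -/
def jet (n : ℕ) (y : F) : Fin n → F := fun i => (Differential.deriv^[(i : ℕ)]) y

/-- The map `y ↦ (y, y′, …)`, linear over the constants. -/
def jetLin (F : Type*) [Field F] [Differential F] (n : ℕ) : F →ₗ[constants F] (Fin n → F) where
  toFun := jet n
  map_add' a b := by ext i; simp [jet, iterate_map_add]
  map_smul' c a := by
    ext i
    simp only [jet, deriv_iterate_constants_smul, RingHom.id_apply, Pi.smul_apply]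
    rfl

end Horizontal

/-! ### Solution spaces: dimension bound and base change -/

section Act

variable {K : Type u} [Field K] [Differential K] {F : Type*} [Field F] [Differential F]
  [Algebra K F]

theorem mem_solutionSpace {P : DiffOp K} {y : F} : y ∈ P.solutionSpace F ↔ P.act y = 0 := Iff.rfl

theorem deriv_iterate_map {E : Type*} [Field E] [Differential E] (φ : E →+* F)
    (hφ : ∀ x, φ x′ = (φ x)′) (n : ℕ) (y : E) :
    (Differential.deriv^[n]) (φ y) = φ ((Differential.deriv^[n]) y) := by
  induction n with
  | zero => rfl
  | succ n ih => rw [Function.iterate_succ_apply', ih, Function.iterate_succ_apply', hφ]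

theorem act_map {E : Type*} [Field E] [Differential E] [Algebra K E] (P : DiffOp K)
    (φ : E →ₐ[K] F) (hφ : ∀ x, φ x′ = (φ x)′) (y : E) : P.act (φ y) = φ (P.act y) := by
  simp only [act, map_sum, map_mul, AlgHom.commutes]
  refine Finset.sum_congr rfl fun i _ => ?_
  rw [← RingHom.coe_coe φ, deriv_iterate_map (φ : E →+* F) hφ]

/-- The companion connection of `P`, for which the jets of the solutions of `P` are horizontal. -/
noncomputable def connection (P : DiffOp K) (F : Type*) [Field F] [Differential F] [Algebra K F] :
    (Fin P.ord → F) →+ (Fin P.ord → F) where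
  toFun v i := (v i)′ - if h : (i : ℕ) + 1 < P.ord then v ⟨i + 1, h⟩ else
    -∑ j : Fin P.ord, algebraMap K F (P.coeff j / P.coeff P.ord) * v j
  map_zero' := by ext i; simp
  map_add' v w := by
    ext i
    simp only [Pi.add_apply, map_add, mul_add, Finset.sum_add_distrib]
    split_ifs <;> ring

theorem connection_smul (P : DiffOp K) (c : F) (v : Fin P.ord → F) :
    P.connection F (c • v) = c′ • v + c • P.connection F v := by
  ext i
  simp only [connection, AddMonoidHom.coe_mk, ZeroHom.coe_mk, Pi.add_apply, Pi.smul_apply,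
    smul_eq_mul, Derivation.leibniz]
  split_ifs
  · ring
  · simp only [mul_left_comm _ c, ← Finset.mul_sum]
    ring

/-- All coordinates but the last vanish by the shape of a jet; the last one is the equation `P · y =
0` divided by its leading coefficient. -/
theorem connection_jet {P : DiffOp K} (hP : P ≠ 0) {y : F} (hy : P.act y = 0) :
    P.connection F (jet P.ord y) = 0 := by
  ext i
  simp only [connection, AddMonoidHom.coe_mk, ZeroHom.coe_mk, jet, Pi.zero_apply,
    ← Function.iterate_succ_apply' (f := Differential.deriv)]
  split_ifs with h
  · simp
  · have hi : (i : ℕ) + 1 = P.ord := by omega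
    have hc : algebraMap K F (P.coeff P.ord) ≠ 0 := by
      simpa using coeff_ord_ne_zero hP
    rw [act, Finset.sum_range_succ, Finset.sum_range] at hy
    rw [Nat.succ_eq_add_one, hi, sub_neg_eq_add]
    refine mul_left_cancel₀ hc ?_
    rw [mul_zero, mul_add, Finset.mul_sum, add_comm, ← hy]
    congr 1
    refine Finset.sum_congr rfl fun j _ => ?_
    rw [map_div₀, ← mul_assoc, mul_div_cancel₀ _ hc]

theorem linearIndependent_jet {P : DiffOp K} (hP : P ≠ 0) {ι : Type*} {y : ι → F}
    (hy : ∀ i, P.act (y i) = 0) (hli : LinearIndependent (constants F) y) :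
    LinearIndependent F (fun i => jet P.ord (y i)) := by
  -- In order zero the jet is empty and forgets `y`, but then `P` is a nonzero scalar without
  -- nonzero solutions. In positive order the jet contains `y` itself, hence is injective.
  rcases Nat.eq_zero_or_pos P.ord with h0 | hpos
  · have hc : algebraMap K F (P.coeff P.ord) ≠ 0 := by simpa using coeff_ord_ne_zero hP
    have : IsEmpty ι := ⟨fun i => by
      have h1 := hy i
      have h2 := hli.ne_zero i
      simp only [act, h0] at h1 hc
      simp at h1 hc
      tauto⟩
    exact linearIndependent_empty_type
  · refine linearIndependent_of_horizontal (P.connection F) P.connection_smul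
      (fun i => connection_jet hP (hy i)) ?_
    refine hli.map' (jetLin F P.ord) ?_
    rw [LinearMap.ker_eq_bot]
    intro a b hab
    exact congrFun hab ⟨0, hpos⟩

theorem card_le_ord {P : DiffOp K} (hP : P ≠ 0) {ι : Type*} [Fintype ι] {y : ι → F}
    (hy : ∀ i, P.act (y i) = 0) (hli : LinearIndependent (constants F) y) :
    Fintype.card ι ≤ P.ord := by
  simpa using (linearIndependent_jet hP hy hli).fintype_card_le_finrank

theorem linearIndependent_jet_basis {P : DiffOp K} (hP : P ≠ 0) {ι : Type*}
    (b : Module.Basis ι (constants F) (P.solutionSpace F)) :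
    LinearIndependent F (fun i => jet P.ord (b i : F)) :=
  linearIndependent_jet hP (fun i => (b i).2)
    (b.linearIndependent.map' (P.solutionSpace F).subtype (Submodule.ker_subtype _))

/-- The jets of a basis are independent in a space of dimension `P.ord`. This rules out the default
value `0` of `finrank` on infinite-dimensional spaces. -/
theorem finite_solutionSpace {P : DiffOp K} (hP : P ≠ 0) :
    Module.Finite (constants F) (P.solutionSpace F) := by
  let b := Module.Basis.ofVectorSpace (constants F) (P.solutionSpace F)
  have := (linearIndependent_jet_basis hP b).finite
  exact Module.Finite.of_basis b

theorem finrank_solutionSpace_le {P : DiffOp K} (hP : P ≠ 0) :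
    Module.finrank (constants F) (P.solutionSpace F) ≤ P.ord := by
  have := finite_solutionSpace (F := F) hP
  let b := Module.finBasis (constants F) (P.solutionSpace F)
  simpa using (linearIndependent_jet_basis hP b).fintype_card_le_finrank

/-- The solutions in `F` of an operator with a full system of solutions in `E` are combinations,
with constant coefficients, of the images of those in `E`. -/
theorem full_map {E : Type*} [Field E] [Differential E] [Algebra K E] {P : DiffOp K} (hP : P ≠ 0)
    (hfull : Module.finrank (constants E) (P.solutionSpace E) = P.ord)
    (φ : E →ₐ[K] F) (hφ : ∀ x, φ x′ = (φ x)′) :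
    Module.finrank (constants F) (P.solutionSpace F) = P.ord ∧
      P.solutionSpace F = Submodule.span (constants F) (φ '' P.solutionSpace E) := by
  have := finite_solutionSpace (F := E) hP
  have := finite_solutionSpace (F := F) hP
  let b := Module.finBasisOfFinrankEq (constants E) (P.solutionSpace E) hfull
  have h1 := linearIndependent_jet_basis hP b
  let A : Matrix (Fin P.ord) (Fin P.ord) E := fun i => jet P.ord (b i : E)
  -- Invertibility of the Wronskian matrix survives any field homomorphism. Hence the images of the
  -- basis stay independent over the possibly larger constants of `F`, and there are already `P.ord`
  -- of them.
  have hA : IsUnit A := Matrix.linearIndependent_rows_iff_isUnit.mp h1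
  have hA' : IsUnit ((φ : E →+* F).mapMatrix A) := hA.map _
  have h2 := Matrix.linearIndependent_rows_iff_isUnit.mpr hA'
  have h3 : LinearIndependent F (fun i => jetLin F P.ord (φ (b i : E))) := by
    convert h2 using 1
    ext i j
    exact deriv_iterate_map (φ : E →+* F) hφ _ _
  have h4 : LinearIndependent (constants F) (fun i => φ (b i : E)) :=
    LinearIndependent.of_comp (jetLin F P.ord) (h3.restrict_scalars' (constants F))
  have hmem : ∀ y ∈ P.solutionSpace E, φ y ∈ P.solutionSpace F := fun y hy => by
    rw [mem_solutionSpace, act_map P φ hφ, mem_solutionSpace.mp hy, map_zero]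
  let w : Fin P.ord → P.solutionSpace F := fun i => ⟨φ (b i), hmem _ (b i).2⟩
  have h5 : LinearIndependent (constants F) w :=
    LinearIndependent.of_comp (P.solutionSpace F).subtype h4
  have h6 : Module.finrank (constants F) (P.solutionSpace F) = P.ord :=
    le_antisymm (finrank_solutionSpace_le hP) (by simpa using h5.fintype_card_le_finrank)
  refine ⟨h6, le_antisymm ?_ (Submodule.span_le.mpr ?_)⟩
  · have h7 := h5.span_eq_top_of_card_eq_finrank' (by simp [h6])
    have h8 := congrArg (Submodule.map (P.solutionSpace F).subtype) h7
    rw [Submodule.map_span, Submodule.map_top, Submodule.range_subtype] at h8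
    rw [← h8]
    refine Submodule.span_mono ?_
    rintro _ ⟨_, ⟨i, rfl⟩, rfl⟩
    exact ⟨b i, (b i).2, rfl⟩
  · rintro _ ⟨y, hy, rfl⟩
    exact hmem y hy

end Act

/-! ### Products of solutions and symmetric powers -/

section SymPow

variable {K : Type u} [Field K] [Differential K]

theorem ne_zero_of_isMonic {P : DiffOp K} (hP : P.IsMonic) : P ≠ 0 := by
  rintro rfl
  exact zero_ne_one (α := K) hP

theorem symPow_ne_zero {L : DiffOp K} (hL : L ≠ 0) (s : ℕ) : L.symPow (s + 1) ≠ 0 := by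
  induction s with
  | zero => exact hL
  | succ s ih => exact ne_zero_of_isMonic (symProd_spec ih hL).monic

theorem solutionSpace_pow_le {L : DiffOp K} (hL : L ≠ 0) (F : Type u) [Field F] [Differential F]
    [Algebra K F] [DifferentialAlgebra K F] (s : ℕ) :
    L.solutionSpace F ^ (s + 1) ≤ (L.symPow (s + 1)).solutionSpace F := by
  induction s with
  | zero => rw [zero_add, pow_one]; exact le_rfl
  | succ s ih =>
    rw [pow_succ, Submodule.mul_le]
    intro f hf g hg
    exact (symProd_spec (symPow_ne_zero hL s) hL).kills F f g (ih hf) hg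

end SymPow

/-! ### Quadratic lower bound from a transcendental solution -/

section Quadratic

theorem linearIndependent_pow_of_transcendental {R A : Type*} [CommRing R] [CommRing A]
    [Algebra R A] {x : A} (hx : Transcendental R x) :
    LinearIndependent R (fun i : ℕ => x ^ i) := by
  have h := (Polynomial.basisMonomials R).linearIndependent.map' (Polynomial.aeval x).toLinearMap
    (LinearMap.ker_eq_bot.mpr (transcendental_iff_injective.mp hx))
  have he : (fun i : ℕ => x ^ i) =
      (Polynomial.aeval x).toLinearMap ∘ Polynomial.basisMonomials R := by
    ext i
    simp
  rw [he]
  exact h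

/-- Differentiating `p(x) = 0` gives `p′(x) = 0`, a relation of lower degree. By induction `p′ = 0`,
so `p` is constant in characteristic zero, and a constant vanishing at `x` is zero. -/
theorem transcendental_constants {K : Type*} [Field K] [Differential K] [CharZero K] {x : K}
    (hx : x′ = 1) : Transcendental (constants K) x := by
  have hder : ∀ p : Polynomial (constants K),
      (Polynomial.aeval x p)′ = Polynomial.aeval x (Polynomial.derivative p) := by
    intro p
    induction p using Polynomial.induction_on' with
    | add p q hp hq => simp only [map_add, hp, hq]
    | monomial n c =>
      have hc : (algebraMap (constants K) K c)′ = 0 := c.2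
      simp only [Polynomial.aeval_monomial, Polynomial.derivative_monomial, Derivation.leibniz, hc,
        Derivation.leibniz_pow, hx, map_mul, map_natCast]
      simp
      ring
  have key : ∀ n : ℕ, ∀ p : Polynomial (constants K), p.natDegree ≤ n →
      Polynomial.aeval x p = 0 → p = 0 := by
    have h0 : ∀ p : Polynomial (constants K), p.natDegree = 0 →
        Polynomial.aeval x p = 0 → p = 0 := by
      intro p hp h
      rw [Polynomial.eq_C_of_natDegree_eq_zero hp] at h ⊢
      simpa using h
    intro n
    induction n with
    | zero => exact fun p hp h => h0 p (Nat.le_zero.mp hp) h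
    | succ n ih =>
      intro p hp h
      refine h0 p (Polynomial.derivative_eq_zero.mp (ih _ ?_ ?_)) h
      · exact (Polynomial.natDegree_derivative_le p).trans (by omega)
      · rw [← hder, h, map_zero]
  exact transcendental_iff.mpr fun p hp => key _ p le_rfl hp

/-- Independence in the tower: powers of `x` over the constants of `K`, powers of `f` over `K`. The
constants of `F` bring nothing new, as they all come from `K`. -/
theorem linearIndependent_pow_mul_pow {K F : Type*} [Field K] [Differential K] [CharZero K]
    [Field F] [Differential F] [Algebra K F] [DifferentialAlgebra K F]
    [Differential.ContainConstants K F] {x : K} (hx : x′ = 1) {f : F} (hf : Transcendental K f) :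
    LinearIndependent (constants F) (fun p : ℕ × ℕ => algebraMap K F x ^ p.1 * f ^ p.2) := by
  have h1 : LinearIndependent (constants K) (fun i : ℕ => x ^ i) :=
    linearIndependent_pow_of_transcendental (transcendental_constants hx)
  have h2 : LinearIndependent K (fun i : ℕ => f ^ i) := linearIndependent_pow_of_transcendental hf
  have h3 := linearIndependent_smul h1 h2
  rw [linearIndependent_iff'] at h3 ⊢
  intro s c hc
  have hlift : ∀ p, ∃ k : constants K, algebraMap K F k = c p := by
    intro p
    obtain ⟨k, hk⟩ := mem_range_of_deriv_eq_zero K (c p).2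
    refine ⟨⟨k, ?_⟩, hk⟩
    refine (algebraMap K F).injective ?_
    change algebraMap K F k′ = _
    rw [← deriv_algebraMap, hk, map_zero]
    exact (c p).2
  choose k hk using hlift
  have h4 := h3 s k (Eq.trans (Finset.sum_congr rfl fun p _ => ?_) hc)
  · intro p hp
    apply Subtype.ext
    rw [← hk, h4 p hp]
    simp
  · change (k p : K) • (x ^ p.1 • f ^ p.2) = (c p : F) * _
    rw [Algebra.smul_def, Algebra.smul_def, hk, map_pow]

variable {K : Type u} [Field K] [Differential K]

/-- The coefficients of `X ^ n` are constants, so no commutator terms arise and the twisted product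
is the ordinary one. -/
theorem mulFun_X_pow (P : Polynomial K) (n : ℕ) :
    mulFun P (Polynomial.X ^ n) = P * Polynomial.X ^ n := by
  have h : ∀ i, (dMul^[i]) (Polynomial.X ^ n : Polynomial K) =
      Polynomial.X ^ i * Polynomial.X ^ n := fun i => by
    rw [← dMul_iterate_one n, ← Function.iterate_add_apply, dMul_iterate_one, dMul_iterate_one,
      pow_add]
  simp only [mulFun, h, ← mul_assoc]
  rw [Polynomial.sum_def, ← Finset.sum_mul]
  congr 1
  exact Polynomial.sum_C_mul_X_pow_eq _

theorem coeff_mul_D_sq (Q : DiffOp K) (i : ℕ) (hi : i < 2) : (Q * D K ^ 2).coeff i = 0 := by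
  rw [sq]
  change (mulFun (K := K) Q (mulFun Polynomial.X Polynomial.X)).coeff i = 0
  have h := mulFun_X_pow (Polynomial.X : Polynomial K) 1
  rw [pow_one, ← sq] at h
  rw [h]
  refine (congrArg (fun p : Polynomial K => p.coeff i) (mulFun_X_pow (K := K) Q 2)).trans ?_
  exact (Polynomial.coeff_mul_X_pow' _ _ _).trans (if_neg (by omega))

/-- A left multiple of `D ^ 2` has no terms of order below `2`, and every other term differentiates
`y′′`. This makes `1` and `x` solutions of `L`. -/
theorem act_of_deriv_deriv_eq_zero {L : DiffOp K} (hL : IsRightFactor (D K ^ 2) L) {F : Type*}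
    [Field F] [Differential F] [Algebra K F] {y : F} (hy : y′′ = 0) : L.act y = 0 := by
  obtain ⟨Q, rfl⟩ := hL
  refine Finset.sum_eq_zero fun i _ => ?_
  rcases Nat.lt_or_ge i 2 with hi | hi
  · rw [coeff_mul_D_sq Q i hi, map_zero, zero_mul]
  · obtain ⟨j, rfl⟩ := Nat.exists_eq_add_of_le' hi
    rw [Function.iterate_add_apply, show (Differential.deriv^[2]) y = y′′ from rfl, hy,
      iterate_map_zero, mul_zero]

/-- If `D ^ 2` is a right factor of an operator with a transcendental solution, then its symmetric
powers have at least quadratic order. -/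
theorem sq_le_ord_symPow [CharZero K] {L : DiffOp K} (hL : L ≠ 0) (hD : IsRightFactor (D K ^ 2) L)
    {x : K} (hx : x′ = 1) (hf : L.HasTranscendentalSolution) (m s : ℕ) (hs : 2 * m ≤ s + 1) :
    (m + 1) ^ 2 ≤ (L.symPow (s + 1)).ord := by
  obtain ⟨F, _, _, _, _, _, f, hfL, hf⟩ := hf
  have h1 := linearIndependent_pow_mul_pow hx hf
  -- Exponents `i, j ≤ m` satisfy `i + j ≤ 2 * m ≤ s + 1`; the missing `r` factors are supplied by
  -- the solution `1`.
  let ι := Fin (m + 1) × Fin (m + 1)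
  let e : ι → ℕ × ℕ := fun p => (p.1, p.2)
  have he : Function.Injective e := fun p q h => by
    simp only [e, Prod.mk.injEq] at h
    exact Prod.ext (Fin.ext h.1) (Fin.ext h.2)
  have h2 := h1.comp e he
  have hx' : (algebraMap K F x)′ = 1 := by rw [deriv_algebraMap, hx, map_one]
  have h1V : (1 : F) ∈ L.solutionSpace F := act_of_deriv_deriv_eq_zero hD (by simp)
  have hxV : algebraMap K F x ∈ L.solutionSpace F :=
    act_of_deriv_deriv_eq_zero hD (by rw [hx']; simp)
  have h3 := card_le_ord (symPow_ne_zero hL s) (y := fun p : ι =>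
    algebraMap K F x ^ (p.1 : ℕ) * f ^ (p.2 : ℕ)) (fun p => ?_) h2
  · simpa [ι, sq] using h3
  · refine solutionSpace_pow_le hL F s ?_
    have hp1 := p.1.2
    have hp2 := p.2.2
    obtain ⟨r, hr⟩ : ∃ r, s + 1 = p.1 + p.2 + r := ⟨s + 1 - (p.1 + p.2), by omega⟩
    rw [hr, pow_add, pow_add]
    have := Submodule.mul_mem_mul (Submodule.mul_mem_mul (Submodule.pow_mem_pow _ hxV p.1)
      (Submodule.pow_mem_pow _ hfL p.2)) (Submodule.pow_mem_pow _ h1V r)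
    simpa using this

end Quadratic

/-! ### Monic annihilators of finite-dimensional spaces -/

section Annihilator

variable {E : Type*} [Field E] [Differential E]

theorem coeff_sub {K : Type u} [Field K] [Differential K] (P Q : DiffOp K) (i : ℕ) :
    (P - Q).coeff i = P.coeff i - Q.coeff i :=
  Polynomial.coeff_sub (R := K) P Q i

theorem act_sub {K : Type u} [Field K] [Differential K] {F : Type*} [Field F] [Differential F]
    [Algebra K F] (P Q : DiffOp K) (y : F) : (P - Q).act y = P.act y - Q.act y := by
  let n := (P - Q).ord + P.ord + Q.ord + 1
  rw [act_eq_sum (P - Q) y n (by omega), act_eq_sum P y n (by omega), act_eq_sum Q y n (by omega)]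
  simp only [coeff_sub, map_sub, sub_mul, Finset.sum_sub_distrib]

theorem finrank_le_ord {K : Type u} [Field K] [Differential K] [Algebra K E]
    {P : DiffOp K} (hP : P ≠ 0) {W : Submodule (constants E) E}
    (hW : ∀ w ∈ W, P.act w = 0) : Module.finrank (constants E) W ≤ P.ord := by
  have := finite_solutionSpace (F := E) hP
  exact (Submodule.finrank_mono (t := P.solutionSpace E) hW).trans (finrank_solutionSpace_le hP)

theorem coeff_eq_zero_of_ord_lt {K : Type u} [Field K] [Differential K] {P : DiffOp K} {i : ℕ}
    (hi : P.ord < i) : P.coeff i = 0 :=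
  Polynomial.coeff_eq_zero_of_natDegree_lt (R := K) hi

/-- A monic operator of order `dim W` that annihilates `W` is unique. -/
theorem eq_of_annihilates {P Q : DiffOp E} {W : Submodule (constants E) E} (hP : P.IsMonic)
    (hQ : Q.IsMonic) (hPo : P.ord = Module.finrank (constants E) W)
    (hQo : Q.ord = Module.finrank (constants E) W) (hPW : ∀ w ∈ W, P.act w = 0)
    (hQW : ∀ w ∈ W, Q.act w = 0) : P = Q := by
  by_contra hne
  have hR : P - Q ≠ 0 := sub_ne_zero.mpr hne
  have h1 := finrank_le_ord hR (W := W) fun w hw => by rw [act_sub, hPW w hw, hQW w hw, sub_zero]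
  refine coeff_ord_ne_zero hR ?_
  rw [coeff_sub]
  -- The difference has order at least `dim W`, yet its coefficient there is `1 - 1` and all higher
  -- ones vanish.
  rcases h1.eq_or_lt with h | h
  · rw [IsMonic, hPo] at hP
    rw [IsMonic, hQo] at hQ
    rw [← h, hP, hQ, sub_self]
  · rw [coeff_eq_zero_of_ord_lt (hPo ▸ h), coeff_eq_zero_of_ord_lt (hQo ▸ h), sub_self]

/-- A space of dimension `n` over the constants is annihilated by a monic operator of order `n`. -/
theorem exists_annihilator (W : Submodule (constants E) E) [Module.Finite (constants E) W] :
    ∃ P : DiffOp E, P.IsMonic ∧ P.ord = Module.finrank (constants E) W ∧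
      ∀ w ∈ W, P.act w = 0 := by
  set n := Module.finrank (constants E) W with hn
  let b := Module.finBasis (constants E) W
  -- There are `n + 1` unknown coefficients and one `E`-linear equation for each of the `n` basis
  -- vectors, so the kernel is nonzero.
  let T : (Fin (n + 1) → E) →ₗ[E] (Fin n → E) :=
    LinearMap.pi fun j => Fintype.linearCombination E fun i : Fin (n + 1) =>
      (Differential.deriv^[(i : ℕ)]) (b j : E)
  obtain ⟨c, hc, hc0⟩ := (Submodule.ne_bot_iff _).mp
    (LinearMap.ker_ne_bot_of_finrank_lt (f := T) (by simp))
  let p : Polynomial E := ∑ i : Fin (n + 1), Polynomial.monomial (i : ℕ) (c i)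
  have hpc : ∀ i : Fin (n + 1), p.coeff i = c i := fun i => by
    simp [p, Polynomial.finsetSum_coeff, Polynomial.coeff_monomial, Fin.val_inj]
  have hpd : p.natDegree ≤ n := Polynomial.natDegree_sum_le_of_forall_le _ _ fun i _ =>
    (Polynomial.natDegree_monomial_le _).trans (Nat.lt_succ_iff.mp i.2)
  let P : DiffOp E := p
  have hP0 : P ≠ 0 := fun h => hc0 <| by
    ext i
    rw [← hpc i, show p = (0 : Polynomial E) from h]
    simp
  have hPb : ∀ j, P.act (b j : E) = 0 := fun j => by
    rw [act_eq_sum P _ (n + 1) (Nat.lt_succ_of_le hpd), Finset.sum_range]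
    have := congrFun (LinearMap.mem_ker.mp hc) j
    simp only [T, LinearMap.pi_apply, Fintype.linearCombination_apply, Pi.zero_apply] at this
    rw [← this]
    exact Finset.sum_congr rfl fun i _ => congrArg (· * _) (hpc i)
  have hPW : ∀ w ∈ W, P.act w = 0 := by
    have hle : W ≤ P.solutionSpace E := by
      have h := congrArg (Submodule.map W.subtype) b.span_eq
      rw [Submodule.map_span, Submodule.map_top, Submodule.range_subtype] at h
      rw [← h, Submodule.span_le]
      rintro _ ⟨_, ⟨j, rfl⟩, rfl⟩
      exact hPb j
    exact fun w hw => hle hw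
  have hord : P.ord = n := le_antisymm hpd (finrank_le_ord hP0 hPW)
  have h0 := inv_ne_zero (coeff_ord_ne_zero hP0)
  let Q : DiffOp E := Polynomial.C (P.coeff P.ord)⁻¹ * p
  have hQord : Q.ord = P.ord := Polynomial.natDegree_C_mul h0
  have hQc : ∀ i, Q.coeff i = (P.coeff P.ord)⁻¹ * P.coeff i := fun i => Polynomial.coeff_C_mul _
  refine ⟨Q, ?_, hQord.trans hord, fun w hw => ?_⟩
  · rw [IsMonic, hQord, hQc, inv_mul_cancel₀ (coeff_ord_ne_zero hP0)]
  · have := hPW w hw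
    simp only [act] at this ⊢
    simp only [hQord, hQc, map_mul, mul_assoc, ← Finset.mul_sum, this, mul_zero]

end Annihilator

/-! ### Galois descent and the order of symmetric powers -/

section Descent

/-- The operator with coefficients `φ p_i`. -/
noncomputable def mapOp {E F : Type*} [Field E] [Differential E] [Field F] [Differential F]
    (φ : E →+* F) (P : DiffOp E) : DiffOp F := Polynomial.map φ P

section

variable {E F : Type*} [Field E] [Differential E] [Field F] [Differential F] (φ : E →+* F)
  (P : DiffOp E)

theorem coeff_mapOp (i : ℕ) : (mapOp φ P).coeff i = φ (P.coeff i) :=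
  Polynomial.coeff_map _ _

theorem ord_mapOp : (mapOp φ P).ord = P.ord := Polynomial.natDegree_map _

theorem act_mapOp (hφ : ∀ x, φ x′ = (φ x)′) (y : E) : (mapOp φ P).act (φ y) = φ (P.act y) := by
  simp only [act, ord_mapOp, coeff_mapOp, deriv_iterate_map φ hφ, map_sum, map_mul]
  rfl

end

variable {K : Type u} [Field K] [Differential K] [CharZero K]
  {E : Type u} [Field E] [Differential E] [Algebra K E] [DifferentialAlgebra K E]

/-- A finite-dimensional space of functions that is stable under the Galois group is annihilated
by an operator of order `dim W` over the base field. -/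
theorem exists_annihilator_of_stable [FiniteDimensional K E] [IsGalois K E]
    (W : Submodule (constants E) E) [Module.Finite (constants E) W]
    (hW : ∀ σ : E ≃ₐ[K] E, ∀ w ∈ W, σ w ∈ W) :
    ∃ P : DiffOp K, P.IsMonic ∧ P.ord = Module.finrank (constants E) W ∧
      ∀ w ∈ W, P.act w = 0 := by
  obtain ⟨Q, hQm, hQo, hQW⟩ := exists_annihilator W
  have hfix : ∀ σ : E ≃ₐ[K] E, mapOp (σ : E →+* E) Q = Q := fun σ => by
    have hσ : ∀ x, (σ : E →+* E) x′ = ((σ : E →+* E) x)′ := fun x =>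
      Differential.algEquiv_deriv' σ x
    refine eq_of_annihilates (W := W) ?_ hQm ((ord_mapOp _ _).trans hQo) hQo (fun w hw => ?_) hQW
    · rw [IsMonic, ord_mapOp, coeff_mapOp, hQm, map_one]
    -- As `σ` commutes with the derivation, the conjugate operator also annihilates `W`; uniqueness
    -- of the monic annihilator then fixes every coefficient.
    · have h := act_mapOp (σ : E →+* E) Q hσ (σ.symm w)
      rw [hQW _ (hW σ.symm w hw), map_zero] at h
      simpa using h
  have hcoe : ∀ i, ∃ k : K, algebraMap K E k = Q.coeff i := fun i =>
    (IsGalois.mem_range_algebraMap_iff_fixed _).mpr fun σ => by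
      conv_rhs => rw [← hfix σ, coeff_mapOp]
      rfl
  obtain ⟨p, hp⟩ : ∃ p : Polynomial K, p.map (algebraMap K E) = Q :=
    (Polynomial.mem_lifts _).mp ((Polynomial.lifts_iff_coeff_lifts _).mpr fun i => hcoe i)
  let P : DiffOp K := p
  have hPQ : mapOp (algebraMap K E) P = Q := hp
  have hord : P.ord = Q.ord := by rw [← hPQ, ord_mapOp]
  refine ⟨P, ?_, hord.trans hQo, fun w hw => ?_⟩
  · refine (algebraMap K E).injective ?_
    rw [← coeff_mapOp, hPQ, hord, hQm, map_one]
  · rw [← hQW w hw, ← hPQ]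
    simp only [act, ord_mapOp, coeff_mapOp]
    rfl

/-- Adjoin to `F` the roots of a polynomial with splitting field `E` over `K`. Derivations extend
uniquely to algebraic extensions in characteristic zero, so the embedding of `E` is automatically
differential. -/
theorem exists_compositum [FiniteDimensional K E] [Normal K E] (F : Type u) [Field F]
    [Differential F] [Algebra K F] [DifferentialAlgebra K F] :
    ∃ (F' : Type u) (_ : Field F') (_ : Differential F') (_ : Algebra K F') (_ : Algebra F F')
      (_ : IsScalarTower K F F') (_ : DifferentialAlgebra F F') (φ : E →ₐ[K] F'),
      ∀ x, φ x′ = (φ x)′ := by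
  obtain ⟨p, hp⟩ := Normal.exists_isSplittingField K E
  have : CharZero F := charZero_of_injective_algebraMap (algebraMap K F).injective
  let F' := (p.map (algebraMap K F)).SplittingField
  let _ : Differential F' := Differential.differentialFiniteDimensional F F'
  have hF : DifferentialAlgebra F F' := Differential.differentialAlgebraFiniteDimensional
  have hK : DifferentialAlgebra K F' := ⟨fun a => by
    rw [IsScalarTower.algebraMap_apply K F F', deriv_algebraMap, deriv_algebraMap,
      ← IsScalarTower.algebraMap_apply K F F']⟩
  have hs : (p.map (algebraMap K F')).Splits := by
    have := Polynomial.SplittingField.splits (p.map (algebraMap K F))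
    rwa [Polynomial.map_map, ← IsScalarTower.algebraMap_eq] at this
  let φ : E →ₐ[K] F' := Polynomial.IsSplittingField.lift E p hs
  exact ⟨F', inferInstance, inferInstance, inferInstance, inferInstance, inferInstance, hF, φ,
    Differential.algHom_deriv' φ φ.toRingHom.injective⟩

/-- In characteristic zero the normal closure is Galois, and it carries the unique extension of the
derivation of `K`. -/
theorem exists_galois_extension [FiniteDimensional K E] :
    ∃ (E' : Type u) (_ : Field E') (_ : Differential E') (_ : Algebra K E')
      (_ : DifferentialAlgebra K E') (_ : FiniteDimensional K E') (_ : IsGalois K E')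
      (φ : E →ₐ[K] E'), ∀ x, φ x′ = (φ x)′ := by
  let E' := IntermediateField.normalClosure K E (AlgebraicClosure E)
  let φ : E →ₐ[K] E' := IsScalarTower.toAlgHom K E E'
  exact ⟨E', inferInstance, inferInstance, inferInstance, inferInstance, inferInstance,
    { }, φ, Differential.algHom_deriv' φ φ.toRingHom.injective⟩

theorem exists_full_galois {L : DiffOp K} (hL : L ≠ 0) (h : L.OnlyAlgebraicSolutions) :
    ∃ (E : Type u) (_ : Field E) (_ : Differential E) (_ : Algebra K E)
      (_ : DifferentialAlgebra K E), FiniteDimensional K E ∧ IsGalois K E ∧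
        Module.finrank (constants E) (L.solutionSpace E) = L.ord := by
  obtain ⟨E, _, _, _, _, _, hE⟩ := h
  obtain ⟨E', _, _, _, _, h1, h2, φ, hφ⟩ := exists_galois_extension (K := K) (E := E)
  exact ⟨E', _, _, _, ‹_›, h1, h2, (full_map hL hE φ hφ).1⟩

open scoped Pointwise in
/-- The symmetric product of two operators with full systems of solutions in a Galois extension
has a full system of solutions there, spanned by the products. -/
theorem full_symProd [FiniteDimensional K E] [IsGalois K E] {M N : DiffOp K} (hM : M ≠ 0)
    (hN : N ≠ 0) (hMf : Module.finrank (constants E) (M.solutionSpace E) = M.ord)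
    (hNf : Module.finrank (constants E) (N.solutionSpace E) = N.ord) :
    Module.finrank (constants E) ((symProd M N).solutionSpace E) = (symProd M N).ord ∧
      (symProd M N).solutionSpace E = M.solutionSpace E * N.solutionSpace E := by
  have hspec := symProd_spec hM hN
  have h0 := ne_zero_of_isMonic hspec.monic
  set W := M.solutionSpace E * N.solutionSpace E
  have hfM := finite_solutionSpace (F := E) hM
  have hfN := finite_solutionSpace (F := E) hN
  have hfW : Module.Finite (constants E) W :=
    Module.Finite.iff_fg.mpr ((Module.Finite.iff_fg.mp hfM).mul (Module.Finite.iff_fg.mp hfN))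
  have hle : W ≤ (symProd M N).solutionSpace E :=
    Submodule.mul_le.mpr fun f hf g hg => hspec.kills E f g hf hg
  have hstab : ∀ (P : DiffOp K) (σ : E ≃ₐ[K] E), ∀ w ∈ P.solutionSpace E,
      σ w ∈ P.solutionSpace E := fun P σ w hw => by
    have := act_map P (σ : E →ₐ[K] E) (Differential.algEquiv_deriv' σ) w
    rw [mem_solutionSpace.mp hw, map_zero] at this
    exact this
  have hstabW : ∀ σ : E ≃ₐ[K] E, ∀ w ∈ W, σ w ∈ W := fun σ w hw => by
    induction hw using Submodule.mul_induction_on' with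
    | mem_mul_mem f hf g hg =>
      rw [map_mul]
      exact Submodule.mul_mem_mul (hstab M σ f hf) (hstab N σ g hg)
    | add x _ y _ hx hy =>
      rw [map_add]
      exact Submodule.add_mem _ hx hy
  obtain ⟨Q, hQm, hQo, hQW⟩ := exists_annihilator_of_stable W hstabW
  -- The products in `F` are moved to a compositum of `F` and `E`, where they are constant
  -- combinations of images of elements of `W`, which `Q` annihilates.
  have hkills : KillsProducts M N Q := by
    intro F _ _ _ _ f g hf hg
    obtain ⟨F', _, _, _, _, _, _, φ, hφ⟩ := exists_compositum (K := K) (E := E) F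
    let ψ : F →ₐ[K] F' := IsScalarTower.toAlgHom K F F'
    have hψ : ∀ x, ψ x′ = (ψ x)′ := fun x => (deriv_algebraMap x).symm
    have hf' : ψ f ∈ M.solutionSpace F' := by
      rw [mem_solutionSpace, act_map M ψ hψ, hf, map_zero]
    have hg' : ψ g ∈ N.solutionSpace F' := by
      rw [mem_solutionSpace, act_map N ψ hψ, hg, map_zero]
    rw [(full_map hM hMf φ hφ).2] at hf'
    rw [(full_map hN hNf φ hφ).2] at hg'
    have hfg := Submodule.mul_mem_mul hf' hg'
    rw [Submodule.span_mul_span] at hfg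
    have hle' : Submodule.span (constants F') ((φ '' M.solutionSpace E) * (φ '' N.solutionSpace E))
        ≤ Q.solutionSpace F' := by
      rw [Submodule.span_le]
      rintro _ ⟨_, ⟨a, ha, rfl⟩, _, ⟨b, hb, rfl⟩, rfl⟩
      change Q.act (φ a * φ b) = 0
      rw [← map_mul, act_map Q φ hφ, hQW _ (Submodule.mul_mem_mul ha hb), map_zero]
    have h1 := mem_solutionSpace.mp (hle' hfg)
    rw [← map_mul, act_map Q ψ hψ] at h1
    exact ψ.toRingHom.injective (h1.trans (map_zero ψ).symm)
  have hord : (symProd M N).ord ≤ Module.finrank (constants E) W :=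
    hQo ▸ hspec.minimal Q hQm hkills
  have hfS := finite_solutionSpace (F := E) h0
  have h2 := finrank_solutionSpace_le (F := E) h0
  have h3 := Submodule.finrank_mono hle
  -- All terms of `dim W ≤ dim (solutions of symProd) ≤ ord ≤ dim W` are equal.
  exact ⟨by omega, (Submodule.eq_of_le_of_finrank_le hle (by omega)).symm⟩

theorem ord_symPow_of_full [FiniteDimensional K E] [IsGalois K E] {L : DiffOp K} (hL : L ≠ 0)
    (hLf : Module.finrank (constants E) (L.solutionSpace E) = L.ord) (s : ℕ) :
    (L.symPow (s + 1)).ord = Module.finrank (constants E)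
      (L.solutionSpace E ^ (s + 1) : Submodule (constants E) E) := by
  -- The induction must also carry fullness and the solution space of the previous power, since
  -- `full_symProd` asks for them.
  suffices h : Module.finrank (constants E) ((L.symPow (s + 1)).solutionSpace E) =
      (L.symPow (s + 1)).ord ∧
      (L.symPow (s + 1)).solutionSpace E = L.solutionSpace E ^ (s + 1) by
    rw [← h.1, h.2]
  induction s with
  | zero => exact ⟨hLf, (pow_one _).symm⟩
  | succ s ih =>
    have h := full_symProd (symPow_ne_zero hL s) hL ih.1 hLf
    exact ⟨h.1, h.2.trans (by rw [ih.2, ← pow_succ])⟩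

end Descent

/-! ### Linear growth for algebraic functions -/

section Linear

open Polynomial

theorem exists_common_denominator {C : Type*} [Field C] (Z : Finset (RatFunc C)) :
    ∃ q : C[X], q ≠ 0 ∧ ∃ B : ℕ, ∀ a ∈ Z, ∃ p : C[X], p.natDegree ≤ B ∧
      a = algebraMap C[X] (RatFunc C) p / algebraMap C[X] (RatFunc C) q := by
  obtain ⟨q, hq⟩ := IsLocalization.exist_integer_multiples_of_finset (nonZeroDivisors C[X]) Z
  have hq0 : (q : C[X]) ≠ 0 := nonZeroDivisors.coe_ne_zero q
  choose! p hp using hq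
  refine ⟨q, hq0, Z.sup fun a => (p a).natDegree, fun a ha =>
    ⟨p a, Finset.le_sup (f := fun a => (p a).natDegree) ha, ?_⟩⟩
  rw [hp a ha, Algebra.smul_def, mul_div_cancel_left₀ _ (RatFunc.algebraMap_ne_zero hq0)]

theorem deriv_algebraMap_polynomial {C : Type*} [Field C] (p : C[X]) :
    (algebraMap C[X] (RatFunc C) p)′ = algebraMap C[X] (RatFunc C) (derivative p) := by
  have h := RatFuncDeriv.derivFun_div p 1 one_ne_zero
  simp only [map_one, div_one, derivative_one, map_zero, mul_zero, sub_zero, mul_one,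
    one_pow] at h
  exact h

theorem deriv_ratFunc_X {C : Type*} [Field C] : (RatFunc.X : RatFunc C)′ = 1 := by
  rw [← RatFunc.algebraMap_X, deriv_algebraMap_polynomial, derivative_X, map_one]

variable {C : Type*} [Field C] {E : Type*} [Field E] [Differential E] [Algebra (RatFunc C) E]
  [DifferentialAlgebra (RatFunc C) E]

open scoped Pointwise in
/-- The dimension of the span of the `s`-fold products of a finite set of algebraic functions grows
at most linearly in `s`. -/
theorem exists_finrank_pow_le [FiniteDimensional (RatFunc C) E] (V : Submodule (constants E) E)
    (hV : V.FG) : ∃ B : ℕ, ∀ s : ℕ,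
      Module.finrank (constants E) (V ^ s : Submodule (constants E) E) ≤ B * (s + 1) := by
  classical
  obtain ⟨S, rfl⟩ := hV
  set K := RatFunc C
  let ι : C[X] →+* K := algebraMap C[X] K
  let e := Module.finBasis K E
  -- One denominator `q` and degree bound `B` serve the coordinates of `1` and the matrix entries of
  -- multiplication by each generator in `S`.
  obtain ⟨q, hq0, B, hB⟩ := exists_common_denominator
    (Finset.univ.image (fun k => e.repr 1 k) ∪
      (S ×ˢ (Finset.univ ×ˢ Finset.univ)).image fun t => e.repr (t.1 * e t.2.1) t.2.2)
  have hιq : ι q ≠ 0 := RatFunc.algebraMap_ne_zero hq0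
  -- The exponent is `s + 1` rather than `s` because the coordinates of `1`, the case `s = 0`, may
  -- already need the denominator `q`. Each further factor costs one `q` and at most `B` in degree.
  let G : (s : ℕ) → Fin (B * (s + 1) + 1) × Fin (Module.finrank K E) → E := fun s t =>
    algebraMap K E (ι (X ^ (t.1 : ℕ)) / ι q ^ (s + 1)) * e t.2
  let T : ℕ → Submodule (constants E) E := fun s => Submodule.span _ (Set.range (G s))
  have hT : ∀ (s : ℕ) (p : C[X]) k, p.natDegree ≤ B * (s + 1) →
      algebraMap K E (ι p / ι q ^ (s + 1)) * e k ∈ T s := by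
    intro s p k hp
    rw [p.as_sum_range' (B * (s + 1) + 1) (Nat.lt_succ_of_le hp), map_sum, Finset.sum_div, map_sum,
      Finset.sum_mul]
    refine Submodule.sum_mem _ fun i hi => ?_
    -- Elements of `C` are constants of `E`, so a numerator is a constant combination of powers of
    -- `X`.
    let c : constants E := ⟨algebraMap K E (ι (Polynomial.C (p.coeff i))), by
      change (algebraMap K E _)′ = 0
      rw [deriv_algebraMap, deriv_algebraMap_polynomial, derivative_C, map_zero, map_zero]⟩
    have h1 : G s (⟨i, Finset.mem_range.mp hi⟩, k) ∈ T s := Submodule.subset_span ⟨_, rfl⟩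
    have h2 := Submodule.smul_mem _ c h1
    convert h2 using 1
    change _ = algebraMap K E (ι (Polynomial.C (p.coeff i))) * (algebraMap K E _ * e k)
    rw [← mul_assoc, ← map_mul, ← C_mul_X_pow_eq_monomial, map_mul, mul_div_assoc]
  have hone : (1 : E) ∈ T 0 := by
    rw [← e.sum_repr 1]
    refine Submodule.sum_mem _ fun k _ => ?_
    obtain ⟨p, hp, hpe⟩ := hB (e.repr 1 k) (Finset.mem_union_left _
      (Finset.mem_image_of_mem _ (Finset.mem_univ k)))
    have := hT 0 p k (by omega)
    rwa [zero_add, pow_one, ← hpe, ← Algebra.smul_def] at this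
  have hmul : ∀ s, Submodule.span (constants E) (S : Set E) * T s ≤ T (s + 1) := by
    intro s
    rw [Submodule.span_mul_span, Submodule.span_le]
    rintro _ ⟨y, hy, _, ⟨t, rfl⟩, rfl⟩
    change y * (algebraMap K E _ * e t.2) ∈ T (s + 1)
    rw [mul_left_comm, ← e.sum_repr (y * e t.2), Finset.mul_sum]
    refine Submodule.sum_mem _ fun l _ => ?_
    obtain ⟨p, hp, hpe⟩ := hB (e.repr (y * e t.2) l) (Finset.mem_union_right _
      (Finset.mem_image.mpr ⟨(y, t.2, l), by simpa using hy, rfl⟩))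
    have hd : (X ^ (t.1 : ℕ) * p).natDegree ≤ B * (s + 1 + 1) := by
      have h1 := t.1.2
      have h2 := natDegree_mul_le (p := (X ^ (t.1 : ℕ) : C[X])) (q := p)
      rw [natDegree_X_pow] at h2
      rw [mul_add B (s + 1) 1]
      omega
    have h := hT (s + 1) _ l hd
    convert h using 1
    rw [Algebra.smul_def, ← mul_assoc, ← map_mul, hpe, map_mul ι, pow_succ (ι q) (s + 1),
      div_mul_div_comm]
  have hle : ∀ s, Submodule.span (constants E) (S : Set E) ^ s ≤ T s := by
    intro s
    induction s with
    | zero => rwa [pow_zero, Submodule.one_le]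
    | succ s ih =>
      rw [pow_succ']
      exact (mul_le_mul_right ih _).trans (hmul s)
  -- The family `G s` has `(B * (s + 1) + 1) * finrank K E` members, and `B * (s + 1) + 1 ≤ (B + 1)
  -- * (s + 1)`.
  refine ⟨(B + 1) * Module.finrank K E, fun s => ?_⟩
  have hfin : Module.Finite (constants E) (T s) :=
    Module.Finite.span_of_finite _ (Set.finite_range _)
  refine (Submodule.finrank_mono (hle s)).trans ((finrank_range_le_card (G s)).trans ?_)
  rw [Fintype.card_prod, Fintype.card_fin, Fintype.card_fin, mul_right_comm]
  refine Nat.mul_le_mul_right _ ?_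
  rw [add_mul]
  omega

end Linear

end DiffOp

/-! ### The two growth rates -/

theorem mainTheorem3 {C : Type u} [Field C] [IsAlgClosed C] [CharZero C]
    (L : DiffOp (RatFunc C)) (hL : L ≠ 0) :
    (L.OnlyAlgebraicSolutions →
      (fun s : ℕ => ((L.symPow s).ord : ℝ)) =O[Filter.atTop] (fun s : ℕ => (s : ℝ))) ∧
    (L.HasTranscendentalSolution →
      DiffOp.IsRightFactor (DiffOp.D (RatFunc C) ^ 2) L →
      (fun s : ℕ => (s : ℝ) ^ 2) =O[Filter.atTop] (fun s : ℕ => ((L.symPow s).ord : ℝ))) := by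
  have : CharZero (RatFunc C) :=
    charZero_of_injective_algebraMap (algebraMap C (RatFunc C)).injective
  refine ⟨fun h => ?_, fun h hD => ?_⟩
  · obtain ⟨E, _, _, _, _, _, _, hE⟩ := DiffOp.exists_full_galois hL h
    obtain ⟨B, hB⟩ := DiffOp.exists_finrank_pow_le (C := C) (L.solutionSpace E)
      (Module.Finite.iff_fg.mp (DiffOp.finite_solutionSpace hL))
    -- The dimension bound for the power `s + 1` is `B * (s + 2)`, at most `2 * B * (s + 1)`.
    refine Asymptotics.IsBigO.of_bound (2 * B) ?_
    filter_upwards [Filter.eventually_ge_atTop 1] with s hs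
    obtain ⟨s, rfl⟩ := Nat.exists_eq_add_of_le' hs
    rw [Real.norm_natCast, Real.norm_natCast, DiffOp.ord_symPow_of_full hL hE]
    have h1 : B * (s + 1 + 1) ≤ 2 * B * (s + 1) := by
      rw [mul_comm 2, mul_assoc]
      exact Nat.mul_le_mul_left _ (by omega)
    exact_mod_cast (hB (s + 1)).trans h1
  -- With `m = (s + 1) / 2` rounded down, `s + 1 ≤ 2 * (m + 1)`; squaring gives the factor `4`.
  · refine Asymptotics.IsBigO.of_bound 4 ?_
    filter_upwards [Filter.eventually_ge_atTop 1] with s hs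
    obtain ⟨s, rfl⟩ := Nat.exists_eq_add_of_le' hs
    rw [norm_pow, Real.norm_natCast, Real.norm_natCast]
    have h1 := DiffOp.sq_le_ord_symPow hL hD DiffOp.deriv_ratFunc_X h ((s + 1) / 2) s (by omega)
    have h2 : (s + 1) ^ 2 ≤ (2 * ((s + 1) / 2 + 1)) ^ 2 := Nat.pow_le_pow_left (by omega) 2
    rw [mul_pow] at h2
    exact_mod_cast (show (s + 1) ^ 2 ≤ 4 * (L.symPow (s + 1)).ord by omega)
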